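/- Let $X_1,X_2,\dots$ be independent random variables with distribution $\mathcal N(\mu,\sigma^2)$, $\mu\in\mathbb R$, $\sigma>0$, and let $T>0$ be fixed. For $n\ge 1$ put $$\bar X=\frac1n\sum_{k=1}^n X_k,\qquad S_X=\Big(\frac1n\sum_{k=1}^n (X_k-\bar X)^2\Big)^{1/2},\qquad \widehat\psi_X(t)=\frac1n\sum_{k=1}^n e^{itX_k},$$ $$\widehat\psi_X^*(t)=e^{-it\bar X/S_X}\,\widehat\psi_X(t/S_X),\qquad \psi_0(t)=e^{-t^2/2},\qquad U_n(t)=\sqrt n\,\big(\widehat\psi_X^*(t)-\psi_0(t)\big)$$ (where quotients by $S_X=0$, an event that has probability zero for $n\ge2$ and always occurs for $n=1$, are read as $0$), and for an integer $m\ge1$ and $t\in[-T,T]$ put $$H_m^{(n)}(t)=(m+1)\frac{U_n(t/\sqrt{m+1})}{\psi_0(t/\sqrt{m+1})}-m\,\frac{U_n(t/\sqrt m)}{\psi_0(t/\sqrt m)} .$$ Let $w$ be a measurable, bounded and nonnegative function on $[-T,T]$ and define $$\mathcal T(f)=\int_{-T}^{T} w(t)\,\psi_0(t)^2\,|f(t)|^2\,dt,\qquad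 f\in C([-T,T];\mathbb C).$$ Then $\mathcal T$ is a nonnegative functional, continuous with respect to the supremum norm, each $U_n(t)$ is a random variable (measurable up to a null set), and: 1. for every real $q>0$, $\ \sup_{n\ge1}\sup_{|t|\le T}\mathbb E\big[|U_n(t)|^q\big]<\infty$; 2. for every fixed integer $m\ge 1$ and every real $p\ge1$, $\ \sup_{n\ge1}\mathbb E\big[\mathcal T(H_m^{(n)})^p\big]<\infty$; 3. for every fixed integer $m\ge 1$ and every real $p\ge1$, the family $\{\mathcal T(H_m^{(n)})^p : n\ge1\}$ is uniformly integrable. -/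

import Mathlib

open MeasureTheory ProbabilityTheory
open scoped NNReal ENNReal

noncomputable section

namespace SelfSimilarityTest

/-- The characteristic function `ψ₀(t) = exp(-t²/2)` of the standard normal distribution. -/
def psi0 (t : ℝ) : ℝ := Real.exp (-t ^ 2 / 2)

theorem charFun_gaussianReal_zero_one (t : ℝ) :
    charFun (gaussianReal 0 1) t = (psi0 t : ℂ) := by
  rw [charFun_gaussianReal, psi0]
  push_cast
  congr 1
  ring

theorem psi0_pos (t : ℝ) : 0 < psi0 t := Real.exp_pos _

theorem continuous_psi0 : Continuous psi0 := by
  unfold psi0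
  fun_prop

/-- The mean of the sample `x₁, …, xₙ`. -/
def sampleMean {n : ℕ} (x : Fin n → ℝ) : ℝ := (1 / (n : ℝ)) * ∑ k, x k

/-- The standard deviation `S` of the sample, with the normalization `1 / n`. -/
def sampleStd {n : ℕ} (x : Fin n → ℝ) : ℝ :=
  Real.sqrt ((1 / (n : ℝ)) * ∑ k, (x k - sampleMean x) ^ 2)

/-- The empirical characteristic function of the sample. -/
def ecf {n : ℕ} (x : Fin n → ℝ) (t : ℝ) : ℂ :=
  (1 / (n : ℂ)) * ∑ k, Complex.exp (Complex.I * (t : ℂ) * (x k : ℂ))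

/-- The standardized empirical characteristic function. A quotient by `S = 0`, which occurs almost
surely if `n = 1` and with probability zero if `n ≥ 2`, is read as `0`. -/
def stdEcf {n : ℕ} (x : Fin n → ℝ) (t : ℝ) : ℂ :=
  Complex.exp (-Complex.I * (t : ℂ) * ((sampleMean x / sampleStd x : ℝ) : ℂ)) *
    ecf x (t / sampleStd x)

/-- `U_n(t) = √n (ψ̂*(t) - ψ₀(t))`. -/
def ecfError {n : ℕ} (x : Fin n → ℝ) (t : ℝ) : ℂ :=
  (Real.sqrt n : ℂ) * (stdEcf x t - (psi0 t : ℂ))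

theorem continuous_ecfError {n : ℕ} (x : Fin n → ℝ) : Continuous (ecfError x) := by
  have h := continuous_psi0
  unfold ecfError stdEcf ecf
  fun_prop

/-- The transformed deviation
`H_m(t) = (m+1) U_n(t/√(m+1)) / ψ₀(t/√(m+1)) - m U_n(t/√m) / ψ₀(t/√m)`, for `t ∈ ℝ`. -/
def deviationFun (m : ℕ) {n : ℕ} (x : Fin n → ℝ) (t : ℝ) : ℂ :=
  ((m : ℂ) + 1) * (ecfError x (t / Real.sqrt (m + 1)) / (psi0 (t / Real.sqrt (m + 1)) : ℂ)) -
    (m : ℂ) * (ecfError x (t / Real.sqrt m) / (psi0 (t / Real.sqrt m) : ℂ))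

theorem continuous_deviationFun (m : ℕ) {n : ℕ} (x : Fin n → ℝ) :
    Continuous (deviationFun m x) := by
  have h := continuous_psi0
  have h' := continuous_ecfError x
  have h0 : ∀ s : ℝ, (psi0 s : ℂ) ≠ 0 := fun s => by exact_mod_cast (psi0_pos s).ne'
  have hq : Continuous fun s : ℝ => ecfError x s / (psi0 s : ℂ) :=
    h'.div (Complex.continuous_ofReal.comp h) h0
  exact (continuous_const.mul (hq.comp (continuous_id.div_const _))).sub
    (continuous_const.mul (hq.comp (continuous_id.div_const _)))

/-- `H_m` as an element of `C([-T, T]; ℂ)`. -/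
def deviation (T : ℝ) (m : ℕ) {n : ℕ} (x : Fin n → ℝ) : C(Set.Icc (-T) T, ℂ) where
  toFun t := deviationFun m x t
  continuous_toFun := (continuous_deviationFun m x).comp continuous_subtype_val

/-- The functional `f ↦ ∫_{-T}^T w(t) ψ₀(t)² |f(t)|² dt` on `C([-T, T]; ℂ)`. -/
def quadFunctional (T : ℝ) (w : ℝ → ℝ) (f : C(Set.Icc (-T) T, ℂ)) : ℝ :=
  ∫ t : Set.Icc (-T) T, w t * psi0 t ^ 2 * ‖f t‖ ^ 2 ∂(volume.comap Subtype.val)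

end SelfSimilarityTest

end

namespace SelfSimilarityTest

/-! Standardization removes location and scale, so `U_n` is the same for the sample and for its
standard normal version `Z = (X - μ) / σ` (`ecfError_affine`). It remains to bound moments under a
product of standard Gaussians, uniformly in `n`.

Pathwise, `|U_n(t)|` is at most a linear combination of `|n^{-1/2} ∑ g(z_k)|` with `g` among `x`,
`x² - 1`, `cos(tx) - ψ₀(t)`, `sin(tx)` (`norm_ecfError_le`). The danger is the division by `S`: it
is harmless because `1/S` only appears multiplied by the mean absolute deviation, which is at most
`S` (`norm_stdEcf_sub_ecf_le`). No negative moments of `S` are needed, and `S = 0` is covered.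

Each such `g` is centred and at most `z² + 2` in modulus, so its normalized sums have exponential
moments near `0`, bounded independently of `n` and `g` (`lintegral_exp_scaledSum_le`); hence all
moments are bounded, uniformly in `t` too. Hölder's inequality and Tonelli's theorem carry this over
to the quadratic functional (`exists_moment_quadFunctional_le`). Uniform integrability of the `p`-th
powers follows from the moment of order `2p`. -/

/-! ### Exponential moments of normalized centred sums -/

/-- Raise `y ≤ exp y`, with `y = x / (8q)`, to the power `q`. The rate `1/8` is the one at which
exponential moments are controlled below. -/
theorem rpow_le_mul_exp {q x : ℝ} (hq : 0 < q) (hx : 0 ≤ x) :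
    x ^ q ≤ (8 * q) ^ q * Real.exp (x / 8) := by
  have h1 : x / (8 * q) ≤ Real.exp (x / (8 * q)) :=
    (by linarith : x / (8 * q) ≤ x / (8 * q) + 1).trans (Real.add_one_le_exp _)
  calc x ^ q = (8 * q * (x / (8 * q))) ^ q := by congr 1; field_simp
    _ = (8 * q) ^ q * (x / (8 * q)) ^ q := Real.mul_rpow (by positivity) (by positivity)
    _ ≤ (8 * q) ^ q * Real.exp (x / (8 * q)) ^ q := by gcongr
    _ = (8 * q) ^ q * Real.exp (x / 8) := by
      rw [← Real.exp_mul]; congr 2; field_simp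

theorem exp_le_one_add_add_sq_mul_exp_abs (x : ℝ) :
    Real.exp x ≤ 1 + x + x ^ 2 * Real.exp |x| := by
  have h := Complex.norm_exp_sub_sum_le_norm_mul_exp (x : ℂ) 2
  simp only [Finset.sum_range_succ, Finset.sum_range_zero, pow_zero, pow_one, Nat.factorial,
    zero_add, Nat.cast_one, div_one, mul_one, Complex.norm_real, Real.norm_eq_abs, sq_abs] at h
  rw [← Complex.ofReal_exp, ← Complex.ofReal_one, ← Complex.ofReal_add, ← Complex.ofReal_sub,
    Complex.norm_real, Real.norm_eq_abs] at h
  linarith [le_abs_self (Real.exp x - (1 + x))]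

/-- A Gaussian-integrable majorant of `g² exp(|g| / 8)` for `|g z| ≤ z² + 2`. -/
noncomputable def expMajorant (z : ℝ) : ℝ := 128 * Real.exp ((z ^ 2 + 2) / 4)

theorem integrable_expMajorant : Integrable expMajorant (gaussianReal 0 1) := by
  rw [gaussianReal_of_var_ne_zero 0 one_ne_zero,
    integrable_withDensity_iff_integrable_smul' (measurable_gaussianPDF _ _)
      (ae_of_all _ fun _ => gaussianPDF_lt_top)]
  have h := (integrable_exp_neg_mul_sq (b := 1 / 4) (by norm_num)).const_mul
    ((Real.sqrt (2 * Real.pi))⁻¹ * 128 * Real.exp (1 / 2))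
  refine h.congr (ae_of_all _ fun z => ?_)
  simp only [toReal_gaussianPDF, gaussianPDFReal, expMajorant, smul_eq_mul, NNReal.coe_one,
    mul_one, sub_zero]
  rw [show (Real.sqrt (2 * Real.pi))⁻¹ * Real.exp (-z ^ 2 / 2) * (128 * Real.exp ((z ^ 2 + 2) / 4))
    = (Real.sqrt (2 * Real.pi))⁻¹ * 128 * (Real.exp (-z ^ 2 / 2) * Real.exp ((z ^ 2 + 2) / 4)) by
      ring, mul_assoc, ← Real.exp_add, ← Real.exp_add]
  congr 2
  ring

/-- With `y = |g| / 8`, the bound `y² / 2 ≤ exp y` gives `g² ≤ 128 exp y`. The total exponent is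
then `|g| / 4 ≤ (z² + 2) / 4`, whose quadratic coefficient `1/4` stays below the Gaussian `1/2`. -/
theorem sq_mul_exp_le_expMajorant {g z : ℝ} (hg : |g| ≤ z ^ 2 + 2) :
    g ^ 2 * Real.exp (|g| / 8) ≤ expMajorant z := by
  have h2 : (|g| / 8) ^ 2 / 2 ≤ Real.exp (|g| / 8) := by
    have := Real.quadratic_le_exp_of_nonneg (x := |g| / 8) (by positivity)
    have : 0 ≤ |g| / 8 := by positivity
    linarith
  have h3 : g ^ 2 ≤ 128 * Real.exp (|g| / 8) := by
    have : g ^ 2 = 128 * ((|g| / 8) ^ 2 / 2) := by rw [div_pow, sq_abs]; ring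
    rw [this]; gcongr
  calc g ^ 2 * Real.exp (|g| / 8) ≤ 128 * Real.exp (|g| / 8) * Real.exp (|g| / 8) := by gcongr
    _ = 128 * Real.exp (|g| / 4) := by rw [mul_assoc, ← Real.exp_add]; congr 2; ring
    _ ≤ expMajorant z := by unfold expMajorant; gcongr

theorem exp_mul_le_of_abs_le {a g z : ℝ} (ha : |a| ≤ 1 / 8) (hg : |g| ≤ z ^ 2 + 2) :
    Real.exp (a * g) ≤ 1 + a * g + a ^ 2 * expMajorant z := by
  refine (exp_le_one_add_add_sq_mul_exp_abs _).trans ?_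
  have h : |a * g| ≤ |g| / 8 := by
    rw [abs_mul]; nlinarith [abs_nonneg g]
  calc 1 + a * g + (a * g) ^ 2 * Real.exp |a * g|
      ≤ 1 + a * g + (a * g) ^ 2 * Real.exp (|g| / 8) := by gcongr
    _ = 1 + a * g + a ^ 2 * (g ^ 2 * Real.exp (|g| / 8)) := by ring
    _ ≤ _ := by gcongr; exact sq_mul_exp_le_expMajorant hg

section ScaledSum

variable {g : ℝ → ℝ} (hgm : Measurable g) (hg : ∀ z, |g z| ≤ z ^ 2 + 2)

include hgm hg

theorem integrable_of_abs_le : Integrable g (gaussianReal 0 1) := by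
  refine integrable_expMajorant.mono' hgm.aestronglyMeasurable (ae_of_all _ fun z => ?_)
  rw [Real.norm_eq_abs, expMajorant]
  have := Real.add_one_le_exp ((z ^ 2 + 2) / 4)
  linarith [hg z, sq_nonneg z]

theorem integrable_exp_mul_of_abs_le {a : ℝ} (ha : |a| ≤ 1 / 8) :
    Integrable (fun z => Real.exp (a * g z)) (gaussianReal 0 1) := by
  have hi := ((integrable_const (1 : ℝ)).add
    ((integrable_of_abs_le hgm hg).const_mul a)).add (integrable_expMajorant.const_mul (a ^ 2))
  refine hi.mono' (by fun_prop) (ae_of_all _ fun z => ?_)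
  rw [Real.norm_eq_abs, Real.abs_exp]
  exact exp_mul_le_of_abs_le ha (hg z)

/-- Centring kills the linear Taylor term, so the exponent is of order `a²`; with `a` of order
`n^{-1/2}` the `n`-th power remains bounded. -/
theorem integral_exp_mul_le (h0 : ∫ z, g z ∂gaussianReal 0 1 = 0) {a : ℝ} (ha : |a| ≤ 1 / 8) :
    ∫ z, Real.exp (a * g z) ∂gaussianReal 0 1 ≤
      Real.exp (a ^ 2 * ∫ z, expMajorant z ∂gaussianReal 0 1) := by
  have i1 : Integrable (fun z => 1 + a * g z) (gaussianReal 0 1) :=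
    (integrable_const _).add ((integrable_of_abs_le hgm hg).const_mul a)
  have i2 := integrable_expMajorant.const_mul (a ^ 2)
  calc ∫ z, Real.exp (a * g z) ∂gaussianReal 0 1
      ≤ ∫ z, (1 + a * g z + a ^ 2 * expMajorant z) ∂gaussianReal 0 1 :=
        integral_mono (integrable_exp_mul_of_abs_le hgm hg ha) (i1.add i2)
          fun z => exp_mul_le_of_abs_le ha (hg z)
    _ = 1 + a ^ 2 * ∫ z, expMajorant z ∂gaussianReal 0 1 := by
      rw [integral_add i1 i2, integral_add (integrable_const _)
        ((integrable_of_abs_le hgm hg).const_mul a), integral_const_mul, integral_const_mul, h0]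
      simp
    _ ≤ _ := by rw [add_comm]; exact Real.add_one_le_exp _

end ScaledSum

/-- The law of a sample of size `n` from the standard normal distribution. -/
noncomputable abbrev stdSample (n : ℕ) : Measure (Fin n → ℝ) := Measure.pi fun _ => gaussianReal 0 1

/-- The normalized sum `n^{-1/2} ∑ g(z_k)`. -/
noncomputable def scaledSum {n : ℕ} (g : ℝ → ℝ) (z : Fin n → ℝ) : ℝ := (Real.sqrt n)⁻¹ * ∑ k, g (z k)

theorem measurable_scaledSum {n : ℕ} {g : ℝ → ℝ} (hg : Measurable g) :
    Measurable (scaledSum (n := n) g) := by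
  unfold scaledSum; fun_prop

/-- By independence the expectation is the `n`-th power of a one-variable integral with parameter `a
= s / √n`, and `n a² = s² ≤ 1`. -/
theorem lintegral_exp_scaledSum_le {n : ℕ} (hn : 0 < n) {g : ℝ → ℝ} (hgm : Measurable g)
    (hg : ∀ z, |g z| ≤ z ^ 2 + 2) (h0 : ∫ z, g z ∂gaussianReal 0 1 = 0) {s : ℝ}
    (hs : |s| ≤ 1 / 8) :
    ∫⁻ z, ENNReal.ofReal (Real.exp (s * scaledSum g z)) ∂stdSample n ≤
      ENNReal.ofReal (Real.exp (∫ z, expMajorant z ∂gaussianReal 0 1)) := by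
  have hn' : (1 : ℝ) ≤ n := by exact_mod_cast hn
  have hsq : 1 ≤ Real.sqrt n := Real.one_le_sqrt.2 hn'
  set a := s * (Real.sqrt n)⁻¹ with ha_def
  have ha : |a| ≤ 1 / 8 := by
    rw [ha_def, abs_mul, abs_of_nonneg (inv_nonneg.2 (Real.sqrt_nonneg _))]
    exact (mul_le_of_le_one_right (abs_nonneg _) (inv_le_one_of_one_le₀ hsq)).trans hs
  have hna : (n : ℝ) * a ^ 2 ≤ 1 := by
    rw [ha_def, mul_pow, inv_pow, Real.sq_sqrt (by positivity)]
    have : (n : ℝ) * (s ^ 2 * (n : ℝ)⁻¹) = s ^ 2 := by field_simp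
    rw [this, ← sq_abs]
    nlinarith [abs_nonneg s]
  have hexp : ∀ z : Fin n → ℝ, Real.exp (s * scaledSum g z) = ∏ k, Real.exp (a * g (z k)) := by
    intro z
    rw [← Real.exp_sum, scaledSum, ← mul_assoc, Finset.mul_sum]
  have hM : 0 ≤ ∫ z, expMajorant z ∂gaussianReal 0 1 :=
    integral_nonneg fun z => by unfold expMajorant; positivity
  simp_rw [hexp]
  rw [← ofReal_integral_eq_lintegral_ofReal
    (Integrable.fintype_prod fun _ => integrable_exp_mul_of_abs_le hgm hg ha)
    (ae_of_all _ fun z => Finset.prod_nonneg fun k _ => (Real.exp_pos _).le)]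
  refine ENNReal.ofReal_le_ofReal ?_
  rw [integral_fintype_prod_eq_prod (fun _ : Fin n => fun z => Real.exp (a * g z))]
  simp only [Finset.prod_const, Finset.card_univ, Fintype.card_fin]
  calc _ ≤ Real.exp (a ^ 2 * ∫ z, expMajorant z ∂gaussianReal 0 1) ^ n :=
        pow_le_pow_left₀ (integral_nonneg fun z => (Real.exp_pos _).le)
          (integral_exp_mul_le hgm hg h0 ha) n
    _ = Real.exp (n * a ^ 2 * ∫ z, expMajorant z ∂gaussianReal 0 1) := by
        rw [← Real.exp_nat_mul, mul_assoc]
    _ ≤ _ := Real.exp_le_exp.2 (mul_le_of_le_one_left hM hna)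

/-- All absolute moments of normalized centred sums are bounded uniformly in the sample size and
in the summand. -/
theorem exists_moment_scaledSum_le {q : ℝ} (hq : 0 < q) :
    ∃ C : ℝ≥0∞, C ≠ ∞ ∧ ∀ n : ℕ, 0 < n → ∀ g : ℝ → ℝ, Measurable g → (∀ z, |g z| ≤ z ^ 2 + 2) →
      ∫ z, g z ∂gaussianReal 0 1 = 0 → ∫⁻ z, ‖scaledSum g z‖ₑ ^ q ∂stdSample n ≤ C := by
  set B := ENNReal.ofReal (Real.exp (∫ z, expMajorant z ∂gaussianReal 0 1))
  refine ⟨ENNReal.ofReal ((8 * q) ^ q) * (B + B),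
    ENNReal.mul_ne_top ENNReal.ofReal_ne_top (by simp [B]), fun n hn g hgm hg h0 => ?_⟩
  have hm := measurable_scaledSum (n := n) hgm
  calc ∫⁻ z, ‖scaledSum g z‖ₑ ^ q ∂stdSample n
      ≤ ∫⁻ z, ENNReal.ofReal ((8 * q) ^ q) *
          (ENNReal.ofReal (Real.exp (1 / 8 * scaledSum g z)) +
            ENNReal.ofReal (Real.exp (-(1 / 8) * scaledSum g z))) ∂stdSample n := by
        refine lintegral_mono fun z => ?_
        rw [← ofReal_norm, ENNReal.ofReal_rpow_of_nonneg (norm_nonneg _) hq.le,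
          ← ENNReal.ofReal_add (Real.exp_pos _).le (Real.exp_pos _).le,
          ← ENNReal.ofReal_mul (by positivity)]
        refine ENNReal.ofReal_le_ofReal ((rpow_le_mul_exp hq (norm_nonneg _)).trans ?_)
        gcongr
        -- `exp(|y| / 8)` is one of `exp(y / 8)` and `exp(-y / 8)`, hence at most their sum.
        rw [Real.norm_eq_abs]
        have e1 := Real.exp_pos (1 / 8 * scaledSum g z)
        have e2 := Real.exp_pos (-(1 / 8) * scaledSum g z)
        rcases abs_cases (scaledSum g z) with ⟨h, -⟩ | ⟨h, -⟩ <;> rw [h]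
        · rw [show scaledSum g z / 8 = 1 / 8 * scaledSum g z by ring]; linarith
        · rw [show -scaledSum g z / 8 = -(1 / 8) * scaledSum g z by ring]; linarith
    _ = ENNReal.ofReal ((8 * q) ^ q) *
          (∫⁻ z, ENNReal.ofReal (Real.exp (1 / 8 * scaledSum g z)) ∂stdSample n +
            ∫⁻ z, ENNReal.ofReal (Real.exp (-(1 / 8) * scaledSum g z)) ∂stdSample n) := by
        rw [lintegral_const_mul _ (by fun_prop), lintegral_add_left (by fun_prop)]
    _ ≤ _ := by
        gcongr
        · exact lintegral_exp_scaledSum_le hn hgm hg h0 (by norm_num [abs_of_pos])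
        · exact lintegral_exp_scaledSum_le hn hgm hg h0 (by norm_num)

/-! ### Affine invariance and the pathwise bound of `U_n` by normalized sums -/

theorem norm_exp_I_mul_sub_exp_I_mul_le (a b : ℝ) :
    ‖Complex.exp (Complex.I * a) - Complex.exp (Complex.I * b)‖ ≤ |a - b| := by
  have h : Complex.exp (Complex.I * a) - Complex.exp (Complex.I * b) =
      Complex.exp (Complex.I * b) * (Complex.exp (Complex.I * ((a - b : ℝ) : ℂ)) - 1) := by
    rw [mul_sub, ← Complex.exp_add, mul_one]
    congr 2
    push_cast
    ring
  rw [h, norm_mul, mul_comm Complex.I (b : ℂ), Complex.norm_exp_ofReal_mul_I, one_mul]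
  exact Real.norm_exp_I_mul_ofReal_sub_one_le

/-- Absorbing the phase shows that only the standardized residuals enter, which makes affine
invariance visible. -/
theorem stdEcf_eq {n : ℕ} (x : Fin n → ℝ) (t : ℝ) :
    stdEcf x t = (1 / (n : ℂ)) * ∑ k, Complex.exp
      (Complex.I * ((t * ((x k - sampleMean x) / sampleStd x) : ℝ) : ℂ)) := by
  rw [stdEcf, ecf, mul_left_comm, Finset.mul_sum]
  congr 1
  refine Finset.sum_congr rfl fun k _ => ?_
  rw [← Complex.exp_add]
  congr 1
  push_cast
  ring

theorem sampleMean_affine {n : ℕ} (hn : 0 < n) (x : Fin n → ℝ) (a b : ℝ) :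
    sampleMean (fun k => a * x k + b) = a * sampleMean x + b := by
  have : (n : ℝ) ≠ 0 := by positivity
  simp only [sampleMean, Finset.sum_add_distrib, ← Finset.mul_sum, Finset.sum_const,
    Finset.card_univ, Fintype.card_fin, nsmul_eq_mul]
  field_simp

theorem sampleStd_affine {n : ℕ} (hn : 0 < n) (x : Fin n → ℝ) {a : ℝ} (ha : 0 ≤ a) (b : ℝ) :
    sampleStd (fun k => a * x k + b) = a * sampleStd x := by
  have h : ∀ k, (a * x k + b - (a * sampleMean x + b)) ^ 2 = a ^ 2 * (x k - sampleMean x) ^ 2 :=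
    fun k => by ring
  simp only [sampleStd, sampleMean_affine hn, h, ← Finset.mul_sum]
  rw [mul_left_comm, Real.sqrt_mul (sq_nonneg a), Real.sqrt_sq ha]

theorem ecfError_affine {n : ℕ} (hn : 0 < n) (x : Fin n → ℝ) {a : ℝ} (ha : 0 < a) (b t : ℝ) :
    ecfError (fun k => a * x k + b) t = ecfError x t := by
  have h : ∀ k, (a * x k + b - (a * sampleMean x + b)) / (a * sampleStd x) =
      (x k - sampleMean x) / sampleStd x := fun k => by
    rw [← mul_div_mul_left _ (sampleStd x) ha.ne']
    congr 1
    ring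
  simp only [ecfError, stdEcf_eq, sampleMean_affine hn, sampleStd_affine hn x ha.le, h]

theorem sqrt_mul_average {n : ℕ} (g : ℝ → ℝ) (z : Fin n → ℝ) :
    Real.sqrt n * ((1 / (n : ℝ)) * ∑ k, g (z k)) = scaledSum g z := by
  rw [scaledSum, ← mul_assoc, mul_one_div, Real.sqrt_div_self', one_div]

theorem sampleStd_sq {n : ℕ} (hn : 0 < n) (z : Fin n → ℝ) :
    sampleStd z ^ 2 = 1 + (1 / (n : ℝ)) * ∑ k, (z k ^ 2 - 1) - sampleMean z ^ 2 := by
  have hn' : (n : ℝ) ≠ 0 := by positivity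
  rw [sampleStd, Real.sq_sqrt (by positivity)]
  have h : ∑ k, z k = n * sampleMean z := by rw [sampleMean]; field_simp
  have h2 : ∀ k, (z k - sampleMean z) ^ 2 =
      z k ^ 2 - 2 * sampleMean z * z k + sampleMean z ^ 2 := fun k => by ring
  simp only [h2, Finset.sum_add_distrib, Finset.sum_sub_distrib, ← Finset.mul_sum, h,
    Finset.sum_const, Finset.card_univ, Fintype.card_fin, nsmul_eq_mul]
  field_simp
  ring

/-- Write `S² - 1 = b - m²` and use `|S - 1| ≤ |S² - 1|`. The term `m²` matters only if `S ≤ 1`: it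
is at most `|m|` when `|m| ≤ 1`, and otherwise `1 - S ≤ 1 ≤ |m|` directly. -/
theorem abs_sampleStd_sub_one_le {n : ℕ} (hn : 0 < n) (z : Fin n → ℝ) :
    |sampleStd z - 1| ≤ |sampleMean z| + |(1 / (n : ℝ)) * ∑ k, (z k ^ 2 - 1)| := by
  have h := sampleStd_sq hn z
  have h0 : 0 ≤ sampleStd z := Real.sqrt_nonneg _
  generalize sampleStd z = s at *
  generalize sampleMean z = m at *
  generalize (1 / (n : ℝ)) * ∑ k, (z k ^ 2 - 1) = b at *
  have hm := sq_abs m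
  have hm0 := abs_nonneg m
  have hb := le_abs_self b
  have hb' := neg_abs_le b
  have hb0 := abs_nonneg b
  rcases le_total s 1 with hs | hs
  · rw [abs_of_nonpos (by linarith)]
    rcases le_total 1 |m| with h1 | h1
    · linarith
    · nlinarith
  · rw [abs_of_nonneg (by linarith)]
    nlinarith

theorem average_abs_sub_le {n : ℕ} (hn : 0 < n) (z : Fin n → ℝ) :
    (1 / (n : ℝ)) * ∑ k, |z k - sampleMean z| ≤ sampleStd z := by
  refine Real.le_sqrt_of_sq_le ?_
  have h := sq_sum_le_card_mul_sum_sq (s := Finset.univ) (f := fun k => |z k - sampleMean z|)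
  simp only [sq_abs, Finset.card_univ, Fintype.card_fin] at h
  have hn' : (0 : ℝ) < n := by positivity
  calc ((1 / (n : ℝ)) * ∑ k, |z k - sampleMean z|) ^ 2
      = (1 / (n : ℝ)) ^ 2 * (∑ k, |z k - sampleMean z|) ^ 2 := mul_pow _ _ _
    _ ≤ (1 / (n : ℝ)) ^ 2 * (n * ∑ k, (z k - sampleMean z) ^ 2) := by gcongr
    _ = _ := by field_simp

/-- The map `u ↦ exp(iu)` is 1-Lipschitz and `(z_k - m) / s - z_k = (1/s - 1)(z_k - m) - m`.
Averaging replaces `|z_k - m|` by at most `s`, which cancels the inverse and leaves `|s - 1|`. -/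
theorem norm_stdEcf_sub_ecf_le {n : ℕ} (hn : 0 < n) (z : Fin n → ℝ) (t : ℝ) :
    ‖stdEcf z t - ecf z t‖ ≤
      |t| * (2 * |sampleMean z| + |(1 / (n : ℝ)) * ∑ k, (z k ^ 2 - 1)|) := by
  have hn' : (0 : ℝ) < n := by positivity
  set m := sampleMean z
  set s := sampleStd z
  have hs : 0 ≤ s := Real.sqrt_nonneg _
  have hk : ∀ k, ‖Complex.exp (Complex.I * ((t * ((z k - m) / s) : ℝ) : ℂ)) -
      Complex.exp (Complex.I * (t : ℂ) * (z k : ℂ))‖ ≤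
        |t| * (|s⁻¹ - 1| * |z k - m| + |m|) := by
    intro k
    rw [mul_assoc, ← Complex.ofReal_mul]
    refine (norm_exp_I_mul_sub_exp_I_mul_le _ _).trans ?_
    rw [← mul_sub, abs_mul,
      show (z k - m) / s - z k = (s⁻¹ - 1) * (z k - m) + -m by ring]
    gcongr
    exact (abs_add_le _ _).trans_eq (by rw [abs_mul, abs_neg])
  rw [stdEcf_eq, ecf, ← mul_sub, ← Finset.sum_sub_distrib, norm_mul]
  calc _ ≤ ‖(1 : ℂ) / n‖ * ∑ k, |t| * (|s⁻¹ - 1| * |z k - m| + |m|) := by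
        gcongr; exact norm_sum_le_of_le _ fun k _ => hk k
    _ = |t| * (|s⁻¹ - 1| * ((1 / (n : ℝ)) * ∑ k, |z k - m|) + |m|) := by
        simp only [norm_div, norm_one, Complex.norm_natCast, ← Finset.mul_sum,
          Finset.sum_add_distrib, Finset.sum_const, Finset.card_univ, Fintype.card_fin,
          nsmul_eq_mul]
        field_simp
    _ ≤ |t| * (|s⁻¹ - 1| * s + |m|) := by gcongr; exact average_abs_sub_le hn z
    _ ≤ |t| * (|s - 1| + |m|) := by
        gcongr
        -- If `s = 0`, the product with the junk inverse vanishes and the bound is trivial; this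
        -- covers `n = 1`.
        rcases hs.eq_or_lt with h | h
        · simp [← h]
        · rw [← abs_of_pos h, ← abs_mul, abs_of_pos h, sub_mul, inv_mul_cancel₀ h.ne', one_mul,
            abs_sub_comm]
    _ ≤ _ := mul_le_mul_of_nonneg_left
        (by linarith [abs_sampleStd_sub_one_le hn z]) (abs_nonneg t)

theorem sqrt_mul_norm_ecf_sub_le {n : ℕ} (hn : 0 < n) (z : Fin n → ℝ) (t : ℝ) :
    Real.sqrt n * ‖ecf z t - (psi0 t : ℂ)‖ ≤
      |scaledSum (fun x => Real.cos (t * x) - psi0 t) z| +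
        |scaledSum (fun x => Real.sin (t * x)) z| := by
  have hn' : (n : ℝ) ≠ 0 := by positivity
  have h : ecf z t - (psi0 t : ℂ) =
      (((1 / (n : ℝ)) * ∑ k, (Real.cos (t * z k) - psi0 t) : ℝ) : ℂ) +
        (((1 / (n : ℝ)) * ∑ k, Real.sin (t * z k) : ℝ) : ℂ) * Complex.I := by
    have he : ∀ k, Complex.exp (Complex.I * (t : ℂ) * (z k : ℂ)) =
        (Real.cos (t * z k) : ℂ) + (Real.sin (t * z k) : ℂ) * Complex.I := fun k => by
      rw [Complex.ofReal_cos, Complex.ofReal_sin, ← Complex.exp_mul_I]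
      congr 1
      push_cast
      ring
    have hn'' : (n : ℂ) ≠ 0 := by exact_mod_cast hn'
    simp only [ecf, he, Finset.sum_add_distrib, ← Finset.sum_mul, Complex.ofReal_mul,
      Complex.ofReal_sum, Complex.ofReal_sub, Finset.sum_sub_distrib, Finset.sum_const,
      Finset.card_univ, Fintype.card_fin, nsmul_eq_mul, Complex.ofReal_div, Complex.ofReal_one,
      Complex.ofReal_natCast]
    field_simp
    ring
  rw [h]
  refine (mul_le_mul_of_nonneg_left (norm_add_le _ _) (Real.sqrt_nonneg _)).trans_eq ?_
  rw [norm_mul, Complex.norm_I, mul_one, Complex.norm_real, Complex.norm_real, Real.norm_eq_abs,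
    Real.norm_eq_abs, mul_add, ← sqrt_mul_average fun x => Real.cos (t * x) - psi0 t,
    ← sqrt_mul_average fun x => Real.sin (t * x), abs_mul (Real.sqrt n), abs_mul (Real.sqrt n),
    abs_of_nonneg (Real.sqrt_nonneg n)]

theorem norm_ecfError_le {n : ℕ} (hn : 0 < n) (z : Fin n → ℝ) (t : ℝ) :
    ‖ecfError z t‖ ≤
      |t| * (2 * |scaledSum (fun x => x) z| + |scaledSum (fun x => x ^ 2 - 1) z|) +
        (|scaledSum (fun x => Real.cos (t * x) - psi0 t) z| +
          |scaledSum (fun x => Real.sin (t * x)) z|) := by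
  have hr := Real.sqrt_nonneg (n : ℝ)
  have h1 := sqrt_mul_average (fun x => x) z
  have h2 := sqrt_mul_average (fun x => x ^ 2 - 1) z
  rw [ecfError, norm_mul, Complex.norm_real, Real.norm_of_nonneg hr,
    ← sub_add_sub_cancel (stdEcf z t) (ecf z t)]
  refine (mul_le_mul_of_nonneg_left (norm_add_le _ _) hr).trans ?_
  rw [mul_add]
  refine add_le_add ?_ (sqrt_mul_norm_ecf_sub_le hn z t)
  refine (mul_le_mul_of_nonneg_left (norm_stdEcf_sub_ecf_le hn z t) hr).trans_eq ?_
  rw [← h1, ← h2, abs_mul (Real.sqrt n), abs_mul (Real.sqrt n), abs_of_nonneg hr, sampleMean]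
  ring

/-! ### Centring of the four summands and uniform moments of `U_n` -/

theorem psi0_le_one (t : ℝ) : psi0 t ≤ 1 :=
  Real.exp_le_one_iff.2 (by nlinarith [sq_nonneg t])

theorem integral_sq_sub_one_gaussianReal : ∫ x, (x ^ 2 - 1) ∂gaussianReal 0 1 = 0 := by
  have hL := memLp_id_gaussianReal (μ := 0) (v := 1) 2
  have h := variance_id_gaussianReal (μ := 0) (v := 1)
  rw [variance_eq_sub hL] at h
  have hi : Integrable (fun x : ℝ => x ^ 2) (gaussianReal 0 1) := hL.integrable_sq
  rw [integral_sub hi (integrable_const _), sub_eq_zero]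
  simpa using h

theorem integral_exp_mul_I_gaussianReal (t : ℝ) :
    ∫ x : ℝ, Complex.exp (t * x * Complex.I) ∂gaussianReal 0 1 = (psi0 t : ℂ) := by
  rw [← charFun_gaussianReal_zero_one, charFun_apply_real]

theorem integrable_exp_mul_I (t : ℝ) :
    Integrable (fun x : ℝ => Complex.exp (t * x * Complex.I)) (gaussianReal 0 1) := by
  refine (integrable_const (1 : ℝ)).mono' (by fun_prop) (ae_of_all _ fun x => ?_)
  rw [← Complex.ofReal_mul, Complex.norm_exp_ofReal_mul_I]

theorem integral_cos_sub_psi0_gaussianReal (t : ℝ) :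
    ∫ x, (Real.cos (t * x) - psi0 t) ∂gaussianReal 0 1 = 0 := by
  have h := Complex.reCLM.integral_comp_comm (integrable_exp_mul_I t)
  rw [integral_exp_mul_I_gaussianReal] at h
  have hi := Complex.reCLM.integrable_comp (integrable_exp_mul_I t)
  simp only [Complex.reCLM_apply, ← Complex.ofReal_mul,
    Complex.exp_ofReal_mul_I_re, Complex.ofReal_re] at h hi
  rw [integral_sub hi (integrable_const _), h]
  simp

theorem integral_sin_gaussianReal (t : ℝ) :
    ∫ x, Real.sin (t * x) ∂gaussianReal 0 1 = 0 := by
  have h := Complex.imCLM.integral_comp_comm (integrable_exp_mul_I t)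
  rw [integral_exp_mul_I_gaussianReal] at h
  simpa only [Complex.imCLM_apply, ← Complex.ofReal_mul,
    Complex.exp_ofReal_mul_I_im, Complex.ofReal_im] using h

/-- The integrated form of `(a + b) ^ q ≤ L * (a ^ q + b ^ q)`, for all `q ≥ 0`. -/
theorem lintegral_rpow_add_le {α : Type*} [MeasurableSpace α] {ν : Measure α} {f g : α → ℝ≥0∞}
    (hf : Measurable f) {q : ℝ} (hq : 0 ≤ q) :
    ∫⁻ a, (f a + g a) ^ q ∂ν ≤ ENNReal.LpAddConst (ENNReal.ofReal q)⁻¹ *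
      (∫⁻ a, f a ^ q ∂ν + ∫⁻ a, g a ^ q ∂ν) := by
  rw [← lintegral_add_left (hf.pow_const q),
    ← lintegral_const_mul' _ _ (ENNReal.LpAddConst_lt_top _).ne]
  exact lintegral_mono fun a => ENNReal.rpow_add_le_mul_rpow_add_rpow' _ _ hq

/-- Uniformity in `t` comes for free: the constant for normalized sums does not depend on the
summand, so it serves all `cos(tx) - ψ₀(t)` and `sin(tx)` at once. -/
theorem exists_moment_ecfError_le (T : ℝ) {q : ℝ} (hq : 0 < q) :
    ∃ C : ℝ≥0∞, C ≠ ∞ ∧ ∀ n : ℕ, 0 < n → ∀ t : ℝ, |t| ≤ T →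
      ∫⁻ z, ‖ecfError z t‖ₑ ^ q ∂stdSample n ≤ C := by
  obtain ⟨C, hC, hmom⟩ := exists_moment_scaledSum_le hq
  set L := ENNReal.LpAddConst (ENNReal.ofReal q)⁻¹ with hL_def
  have hL : L ≠ ∞ := (ENNReal.LpAddConst_lt_top _).ne
  refine ⟨L * (ENNReal.ofReal T ^ q * (L * (2 ^ q * C + C)) + L * (C + C)), ?_,
    fun n hn t ht => ?_⟩
  · have h1 := ENNReal.rpow_ne_top_of_nonneg hq.le (ENNReal.ofReal_ne_top (r := T))
    have h2 := ENNReal.rpow_ne_top_of_nonneg hq.le (ENNReal.ofNat_ne_top (n := 2))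
    finiteness
  set g1 : ℝ → ℝ := fun x => x
  set g2 : ℝ → ℝ := fun x => x ^ 2 - 1
  set g3 : ℝ → ℝ := fun x => Real.cos (t * x) - psi0 t
  set g4 : ℝ → ℝ := fun x => Real.sin (t * x)
  have m1 : Measurable g1 := measurable_id
  have m2 : Measurable g2 := by fun_prop
  have m3 : Measurable g3 := by fun_prop
  have m4 : Measurable g4 := by fun_prop
  have b1 := hmom n hn g1 m1
    (fun z => abs_le.2 ⟨by nlinarith [sq_nonneg (z + 1)], by nlinarith [sq_nonneg (z - 1)]⟩)
    integral_id_gaussianReal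
  have b2 := hmom n hn g2 m2 (fun z => abs_le.2 ⟨by nlinarith [sq_nonneg z], by linarith⟩)
    integral_sq_sub_one_gaussianReal
  have b3 := hmom n hn g3 m3 (fun z => by
    have h0 := (psi0_pos t).le
    have h1 := psi0_le_one t
    exact abs_le.2 ⟨by linarith [Real.neg_one_le_cos (t * z), sq_nonneg z],
      by linarith [Real.cos_le_one (t * z), sq_nonneg z]⟩) (integral_cos_sub_psi0_gaussianReal t)
  have b4 := hmom n hn g4 m4
    (fun z => (Real.abs_sin_le_one _).trans (by linarith [sq_nonneg z]))
    (integral_sin_gaussianReal t)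
  have s1 := measurable_scaledSum (n := n) m1
  have s2 := measurable_scaledSum (n := n) m2
  have s3 := measurable_scaledSum (n := n) m3
  calc ∫⁻ z, ‖ecfError z t‖ₑ ^ q ∂stdSample n
      ≤ ∫⁻ z, (ENNReal.ofReal T * (2 * ‖scaledSum g1 z‖ₑ + ‖scaledSum g2 z‖ₑ) +
          (‖scaledSum g3 z‖ₑ + ‖scaledSum g4 z‖ₑ)) ^ q ∂stdSample n := by
        refine lintegral_mono fun z => ENNReal.rpow_le_rpow ?_ hq.le
        simp only [← ofReal_norm]
        rw [← ENNReal.ofReal_ofNat 2, ← ENNReal.ofReal_mul (by norm_num),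
          ← ENNReal.ofReal_add (by positivity) (by positivity),
          ← ENNReal.ofReal_mul ((abs_nonneg t).trans ht),
          ← ENNReal.ofReal_add (by positivity) (by positivity),
          ← ENNReal.ofReal_add (mul_nonneg ((abs_nonneg t).trans ht) (by positivity))
            (by positivity)]
        refine ENNReal.ofReal_le_ofReal ((norm_ecfError_le hn z t).trans ?_)
        simp only [Real.norm_eq_abs]
        gcongr
    _ ≤ L * (∫⁻ z, (ENNReal.ofReal T * (2 * ‖scaledSum g1 z‖ₑ + ‖scaledSum g2 z‖ₑ)) ^ q
          ∂stdSample n + ∫⁻ z, (‖scaledSum g3 z‖ₑ + ‖scaledSum g4 z‖ₑ) ^ q ∂stdSample n) :=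
        lintegral_rpow_add_le (by fun_prop) hq.le
    _ ≤ _ := by
        simp only [ENNReal.mul_rpow_of_nonneg _ _ hq.le]
        rw [lintegral_const_mul _ (by fun_prop)]
        gcongr
        · refine (lintegral_rpow_add_le (by fun_prop) hq.le).trans ?_
          simp only [ENNReal.mul_rpow_of_nonneg _ _ hq.le]
          rw [lintegral_const_mul _ (by fun_prop)]
          gcongr
        · refine (lintegral_rpow_add_le (by fun_prop) hq.le).trans ?_
          gcongr

/-! ### Measurability and the quadratic functional -/

theorem measurable_ecfError {α : Type*} [MeasurableSpace α] {n : ℕ} {x : α → Fin n → ℝ}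
    {t : α → ℝ} (hx : Measurable x) (ht : Measurable t) :
    Measurable fun a => ecfError (x a) (t a) := by
  have hm : Measurable fun a => sampleMean (x a) := by
    unfold sampleMean; fun_prop
  have hs : Measurable fun a => sampleStd (x a) := by
    unfold sampleStd sampleMean; fun_prop
  have hp : Measurable fun a => psi0 (t a) := continuous_psi0.measurable.comp ht
  unfold ecfError stdEcf ecf
  fun_prop

theorem measurable_deviationFun {α : Type*} [MeasurableSpace α] (m : ℕ) {n : ℕ}
    {x : α → Fin n → ℝ} {t : α → ℝ} (hx : Measurable x) (ht : Measurable t) :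
    Measurable fun a => deviationFun m (x a) (t a) := by
  have h : ∀ c : ℝ, Measurable fun a => ecfError (x a) (t a / c) / (psi0 (t a / c) : ℂ) :=
    fun c => (measurable_ecfError hx (ht.div_const c)).div
      (Complex.measurable_ofReal.comp (continuous_psi0.measurable.comp (ht.div_const c)))
  exact ((h (Real.sqrt (m + 1))).const_mul ((m : ℂ) + 1)).sub
    ((h (Real.sqrt m)).const_mul (m : ℂ))

instance isFiniteMeasure_comap_Icc (T : ℝ) :
    IsFiniteMeasure ((volume : Measure ℝ).comap (Subtype.val : Set.Icc (-T) T → ℝ)) :=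
  ⟨by
    rw [comap_subtype_coe_apply measurableSet_Icc, Set.image_univ, Subtype.range_coe]
    exact measure_Icc_lt_top⟩

section QuadFunctional

variable {T : ℝ} {w : ℝ → ℝ}

theorem quadFunctional_nonneg (hw_nonneg : ∀ t ∈ Set.Icc (-T) T, 0 ≤ w t)
    (f : C(Set.Icc (-T) T, ℂ)) : 0 ≤ quadFunctional T w f :=
  integral_nonneg fun t => mul_nonneg (mul_nonneg (hw_nonneg t t.2) (sq_nonneg _)) (sq_nonneg _)

theorem norm_quadFunctional_integrand_le (hw_nonneg : ∀ t ∈ Set.Icc (-T) T, 0 ≤ w t) {K : ℝ}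
    (hK : ∀ t ∈ Set.Icc (-T) T, w t ≤ K) (t : Set.Icc (-T) T) (r : ℝ) :
    ‖w t * psi0 t ^ 2 * r ^ 2‖ ≤ K * r ^ 2 := by
  have h0 := hw_nonneg t t.2
  rw [Real.norm_of_nonneg (by positivity)]
  have h1 : psi0 t ^ 2 ≤ 1 := pow_le_one₀ (psi0_pos _).le (psi0_le_one _)
  gcongr
  calc w t * psi0 t ^ 2 ≤ w t * 1 := by gcongr
    _ ≤ K := by rw [mul_one]; exact hK t t.2

/-- Dominated convergence: on the unit ball around `f` the integrand is at most `K (‖f‖ + 1)²`, and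
the interval has finite measure. -/
theorem continuous_quadFunctional
    (hw_meas : AEMeasurable w (volume.restrict (Set.Icc (-T) T)))
    (hw_nonneg : ∀ t ∈ Set.Icc (-T) T, 0 ≤ w t) {K : ℝ}
    (hK : ∀ t ∈ Set.Icc (-T) T, w t ≤ K) (hK0 : 0 ≤ K) :
    Continuous (quadFunctional T w) := by
  have hw := (aemeasurable_restrict_iff_comap_subtype measurableSet_Icc).1 hw_meas
  have hpsi : Measurable fun t : Set.Icc (-T) T => psi0 t :=
    continuous_psi0.measurable.comp measurable_subtype_coe
  refine continuous_iff_continuousAt.2 fun f => ?_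
  refine continuousAt_of_dominated (bound := fun _ => K * (‖f‖ + 1) ^ 2)
    (Filter.Eventually.of_forall fun g => ?_) ?_ (integrable_const _)
    (ae_of_all _ fun t => ?_)
  · exact ((hw.mul (hpsi.pow_const 2).aemeasurable).mul
      (g.continuous.norm.measurable.pow_const 2).aemeasurable).aestronglyMeasurable
  · filter_upwards [Metric.ball_mem_nhds f one_pos] with g hg
    refine ae_of_all _ fun t => (norm_quadFunctional_integrand_le hw_nonneg hK t _).trans ?_
    have h1 : ‖g t‖ ≤ ‖f‖ + 1 := by
      have h2 : ‖g‖ ≤ ‖f‖ + ‖g - f‖ := norm_le_norm_add_norm_sub' g f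
      rw [Metric.mem_ball, dist_eq_norm] at hg
      linarith [g.norm_coe_le_norm t]
    gcongr
  · exact (continuous_const.mul
      ((continuous_eval_const t).norm.pow 2)).continuousAt

theorem measurable_quadFunctional_deviation
    (hw_meas : AEMeasurable w (volume.restrict (Set.Icc (-T) T))) (m n : ℕ) :
    Measurable fun z : Fin n → ℝ => quadFunctional T w (deviation T m z) := by
  have hw := (aemeasurable_restrict_iff_comap_subtype measurableSet_Icc).1 hw_meas
  have hpsi : Measurable fun t : Set.Icc (-T) T => psi0 t :=
    continuous_psi0.measurable.comp measurable_subtype_coe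
  have hD : Measurable fun p : (Fin n → ℝ) × Set.Icc (-T) T => deviationFun m p.1 (p.2 : ℝ) :=
    measurable_deviationFun m measurable_fst (measurable_subtype_coe.comp measurable_snd)
  -- Since `w` is only a.e. measurable, a measurable version replaces it, so that the integrand is
  -- jointly measurable in `(z, t)`.
  have h : (fun z : Fin n → ℝ => quadFunctional T w (deviation T m z)) = fun z =>
      ∫ t, hw.mk _ t * psi0 t ^ 2 * ‖deviationFun m z t‖ ^ 2 ∂(volume.comap Subtype.val) := by
    funext z
    refine integral_congr_ae ?_
    filter_upwards [hw.ae_eq_mk] with t ht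
    rw [← ht]
    rfl
  rw [h]
  refine StronglyMeasurable.measurable
    (MeasureTheory.StronglyMeasurable.integral_prod_right
      (f := fun (z : Fin n → ℝ) (t : Set.Icc (-T) T) =>
        hw.mk _ t * psi0 t ^ 2 * ‖deviationFun m z t‖ ^ 2) ?_)
  exact (((hw.measurable_mk.comp measurable_snd).mul
    ((hpsi.comp measurable_snd).pow_const 2)).mul (hD.norm.pow_const 2)).stronglyMeasurable

/-- Comparison of the `L¹` and `L^p` norms of `|f|²` on a space of finite measure. It moves the
power inside the integral, ready for Tonelli. -/
theorem exists_quadFunctional_rpow_le (hw_nonneg : ∀ t ∈ Set.Icc (-T) T, 0 ≤ w t) {K : ℝ}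
    (hK : ∀ t ∈ Set.Icc (-T) T, w t ≤ K) (hK0 : 0 ≤ K) {p : ℝ} (hp : 1 ≤ p) :
    ∃ C : ℝ≥0∞, C ≠ ∞ ∧ ∀ f : C(Set.Icc (-T) T, ℂ),
      ENNReal.ofReal (quadFunctional T w f ^ p) ≤
        C * ∫⁻ t, ‖f t‖ₑ ^ (2 * p) ∂(volume.comap Subtype.val) := by
  set ν : Measure (Set.Icc (-T) T) := volume.comap Subtype.val
  have hp0 : 0 < p := by linarith
  have hp1 : 0 ≤ 1 / 1 - 1 / p := by
    rw [sub_nonneg]; exact one_div_le_one_div_of_le one_pos hp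
  refine ⟨(ENNReal.ofReal K * ν Set.univ ^ (1 / 1 - 1 / p)) ^ p,
    ENNReal.rpow_ne_top_of_nonneg hp0.le (ENNReal.mul_ne_top ENNReal.ofReal_ne_top
      (ENNReal.rpow_ne_top_of_nonneg hp1 (measure_ne_top _ _))), fun f => ?_⟩
  have hQ := quadFunctional_nonneg hw_nonneg f
  have h1 : ENNReal.ofReal (quadFunctional T w f) ≤
      ENNReal.ofReal K * ∫⁻ t, ‖‖f t‖ ^ 2‖ₑ ∂ν := by
    rw [← Real.enorm_of_nonneg hQ, ← lintegral_const_mul' _ _ ENNReal.ofReal_ne_top]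
    refine (enorm_integral_le_lintegral_enorm _).trans (lintegral_mono fun t => ?_)
    rw [← ofReal_norm, Real.enorm_of_nonneg (sq_nonneg _), ← ENNReal.ofReal_mul hK0]
    exact ENNReal.ofReal_le_ofReal (norm_quadFunctional_integrand_le hw_nonneg hK t _)
  have h2 := eLpNorm'_le_eLpNorm'_mul_rpow_measure_univ (μ := ν) (f := fun t => ‖f t‖ ^ 2)
    one_pos hp (f.continuous.norm.pow 2).measurable.aestronglyMeasurable
  simp only [eLpNorm', ENNReal.rpow_one, div_one] at h2
  rw [← ENNReal.ofReal_rpow_of_nonneg hQ hp0.le]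
  have h3 : ∀ t, ‖‖f t‖ ^ 2‖ₑ ^ p = ‖f t‖ₑ ^ (2 * p) := fun t => by
    rw [enorm_pow, enorm_norm, ENNReal.rpow_mul, ENNReal.rpow_ofNat]
  simp only [h3] at h2
  calc ENNReal.ofReal (quadFunctional T w f) ^ p
      ≤ (ENNReal.ofReal K * ((∫⁻ t, ‖f t‖ₑ ^ (2 * p) ∂ν) ^ (1 / p) *
          ν Set.univ ^ (1 - 1 / p))) ^ p := by
        gcongr
        exact h1.trans (mul_le_mul_right h2 _)
    _ = _ := by
        rw [mul_left_comm, ENNReal.mul_rpow_of_nonneg _ _ hp0.le, ← ENNReal.rpow_mul,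
          one_div_mul_cancel hp0.ne', ENNReal.rpow_one, mul_comm, div_one]

end QuadFunctional

/-! ### Moments of the deviation and of the functional -/

theorem psi0_le_psi0_of_abs_le {s t : ℝ} (h : |s| ≤ t) : psi0 t ≤ psi0 s := by
  have : s ^ 2 ≤ t ^ 2 := sq_le_sq' (abs_le.1 h).1 (abs_le.1 h).2
  unfold psi0
  gcongr

theorem enorm_deviationFun_le (m : ℕ) {n : ℕ} (z : Fin n → ℝ) {T t : ℝ}
    (h1 : |t / Real.sqrt (m + 1)| ≤ T) (h2 : |t / Real.sqrt m| ≤ T) :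
    ‖deviationFun m z t‖ₑ ≤ ENNReal.ofReal ((m + 1) / psi0 T) *
      (‖ecfError z (t / Real.sqrt (m + 1))‖ₑ + ‖ecfError z (t / Real.sqrt m)‖ₑ) := by
  have hT := psi0_pos T
  simp only [← ofReal_norm]
  rw [← ENNReal.ofReal_add (norm_nonneg _) (norm_nonneg _), ← ENNReal.ofReal_mul (by positivity)]
  refine ENNReal.ofReal_le_ofReal ((norm_sub_le _ _).trans ?_)
  have hd : ∀ {s : ℝ}, |s| ≤ T → ‖ecfError z s / (psi0 s : ℂ)‖ ≤ ‖ecfError z s‖ / psi0 T := by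
    intro s hs
    rw [norm_div, Complex.norm_real, Real.norm_of_nonneg (psi0_pos s).le]
    gcongr
    exact psi0_le_psi0_of_abs_le hs
  have hm : ‖(m : ℂ) + 1‖ = (m : ℝ) + 1 := by
    rw [← Nat.cast_add_one, Complex.norm_natCast]; push_cast; rfl
  rw [norm_mul, norm_mul, hm, Complex.norm_natCast]
  calc _ ≤ ((m : ℝ) + 1) * (‖ecfError z (t / Real.sqrt (m + 1))‖ / psi0 T) +
        ((m : ℝ) + 1) * (‖ecfError z (t / Real.sqrt m)‖ / psi0 T) := by
        refine add_le_add (mul_le_mul_of_nonneg_left (hd h1) (by positivity))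
          (mul_le_mul (by linarith) (hd h2) (norm_nonneg _) (by positivity))
    _ = _ := by ring

theorem exists_moment_deviationFun_le (T : ℝ) {m : ℕ} (hm : 1 ≤ m) {q : ℝ} (hq : 0 < q) :
    ∃ C : ℝ≥0∞, C ≠ ∞ ∧ ∀ n : ℕ, 0 < n → ∀ t : ℝ, |t| ≤ T →
      ∫⁻ z, ‖deviationFun m z t‖ₑ ^ q ∂stdSample n ≤ C := by
  obtain ⟨C, hC, hmom⟩ := exists_moment_ecfError_le T hq
  have hL := (ENNReal.LpAddConst_lt_top (ENNReal.ofReal q)⁻¹).ne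
  have hK := ENNReal.rpow_ne_top_of_nonneg hq.le
    (ENNReal.ofReal_ne_top (r := ((m : ℝ) + 1) / psi0 T))
  refine ⟨ENNReal.ofReal (((m : ℝ) + 1) / psi0 T) ^ q *
    (ENNReal.LpAddConst (ENNReal.ofReal q)⁻¹ * (C + C)), by finiteness, fun n hn t ht => ?_⟩
  have hm' : (1 : ℝ) ≤ m := by exact_mod_cast hm
  -- Because `m ≥ 1`, both rescaled arguments stay in `[-T, T]`, where the moment bound holds and
  -- `ψ₀ ≥ ψ₀(T)`.
  have hdiv : ∀ c : ℝ, 1 ≤ c → |t / Real.sqrt c| ≤ T := fun c hc => by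
    rw [abs_div, abs_of_nonneg (Real.sqrt_nonneg c)]
    exact (div_le_self (abs_nonneg t) (Real.one_le_sqrt.2 hc)).trans ht
  have h1 := hdiv (m + 1) (by linarith)
  have h2 := hdiv m hm'
  have hU : Measurable fun z : Fin n → ℝ => ‖ecfError z (t / Real.sqrt (m + 1))‖ₑ :=
    (measurable_ecfError measurable_id measurable_const).enorm
  calc ∫⁻ z, ‖deviationFun m z t‖ₑ ^ q ∂stdSample n
      ≤ ∫⁻ z, ENNReal.ofReal ((m + 1) / psi0 T) ^ q *
        (‖ecfError z (t / Real.sqrt (m + 1))‖ₑ + ‖ecfError z (t / Real.sqrt m)‖ₑ) ^ q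
          ∂stdSample n := by
        refine lintegral_mono fun z => ?_
        rw [← ENNReal.mul_rpow_of_nonneg _ _ hq.le]
        exact ENNReal.rpow_le_rpow (enorm_deviationFun_le m z h1 h2) hq.le
    _ ≤ _ := by
        rw [lintegral_const_mul' _ _ hK]
        gcongr
        refine (lintegral_rpow_add_le hU hq.le).trans ?_
        gcongr
        · exact hmom n hn _ h1
        · exact hmom n hn _ h2

theorem exists_moment_quadFunctional_le {T : ℝ} {w : ℝ → ℝ}
    (hw_nonneg : ∀ t ∈ Set.Icc (-T) T, 0 ≤ w t) {K : ℝ}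
    (hK : ∀ t ∈ Set.Icc (-T) T, w t ≤ K) (hK0 : 0 ≤ K) {m : ℕ} (hm : 1 ≤ m) {p : ℝ}
    (hp : 1 ≤ p) :
    ∃ C : ℝ≥0∞, C ≠ ∞ ∧ ∀ n : ℕ, 0 < n →
      ∫⁻ z, ENNReal.ofReal (quadFunctional T w (deviation T m z) ^ p) ∂stdSample n ≤ C := by
  obtain ⟨A, hA, hQ⟩ := exists_quadFunctional_rpow_le hw_nonneg hK hK0 hp
  obtain ⟨C, hC, hmom⟩ :=
    exists_moment_deviationFun_le T hm (q := 2 * p) (by linarith)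
  set ν : Measure (Set.Icc (-T) T) := volume.comap Subtype.val
  refine ⟨A * (C * ν Set.univ), ENNReal.mul_ne_top hA
    (ENNReal.mul_ne_top hC (measure_ne_top _ _)), fun n hn => ?_⟩
  have hD : Measurable fun p : (Fin n → ℝ) × Set.Icc (-T) T => deviationFun m p.1 (p.2 : ℝ) :=
    measurable_deviationFun m measurable_fst (measurable_subtype_coe.comp measurable_snd)
  calc ∫⁻ z, ENNReal.ofReal (quadFunctional T w (deviation T m z) ^ p) ∂stdSample n
      ≤ ∫⁻ z, A * ∫⁻ t, ‖deviationFun m z t‖ₑ ^ (2 * p) ∂ν ∂stdSample n :=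
        lintegral_mono fun z => hQ _
    _ = A * ∫⁻ t : Set.Icc (-T) T, ∫⁻ z, ‖deviationFun m z t‖ₑ ^ (2 * p) ∂stdSample n ∂ν := by
        rw [lintegral_const_mul' _ _ hA,
          lintegral_lintegral_swap (hD.enorm.pow_const (2 * p)).aemeasurable]
    _ ≤ A * ∫⁻ _ : Set.Icc (-T) T, C ∂ν := by
        gcongr with t
        exact hmom n hn t (abs_le.2 t.2)
    _ = _ := by rw [lintegral_const]

theorem deviation_affine (T : ℝ) (m : ℕ) {n : ℕ} (hn : 0 < n) (x : Fin n → ℝ) {a : ℝ}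
    (ha : 0 < a) (b : ℝ) : deviation T m (fun k => a * x k + b) = deviation T m x := by
  ext t
  change deviationFun m _ _ = deviationFun m _ _
  simp only [deviationFun, ecfError_affine hn x ha]

/-! ### Uniform integrability from bounded second moments -/

/-- Where `|f| ≥ K` one has `K |f| ≤ f²`, so the tail integral is at most `C / K`. -/
theorem uniformIntegrable_one_of_lintegral_sq_le {ι Ω : Type*} [MeasurableSpace Ω]
    {P : Measure Ω} [IsFiniteMeasure P] {f : ι → Ω → ℝ}
    (hf : ∀ i, AEStronglyMeasurable (f i) P) {C : ℝ≥0∞} (hC : C ≠ ∞)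
    (hfC : ∀ i, ∫⁻ ω, ‖f i ω‖ₑ ^ 2 ∂P ≤ C) : UniformIntegrable f 1 P := by
  refine uniformIntegrable_of le_rfl ENNReal.one_ne_top hf fun ε hε => ?_
  -- The quotient gives `C ≤ K ε`; the added `1` keeps `K` nonzero for the final cancellation, even
  -- if `C = 0`.
  set K : ℝ≥0 := C.toNNReal / ε.toNNReal + 1
  have hε' : 0 < ε.toNNReal := Real.toNNReal_pos.2 hε
  refine ⟨K, fun i => ?_⟩
  have h1 : (K : ℝ≥0∞) * eLpNorm ({x | K ≤ ‖f i x‖₊}.indicator (f i)) 1 P ≤ C := by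
    rw [eLpNorm_one_eq_lintegral_enorm, ← lintegral_const_mul' _ _ ENNReal.coe_ne_top]
    refine (lintegral_mono fun ω => ?_).trans (hfC i)
    by_cases h : ω ∈ {x | K ≤ ‖f i x‖₊}
    · rw [Set.indicator_of_mem h, sq]
      gcongr
      exact ENNReal.coe_le_coe.2 h
    · rw [Set.indicator_of_notMem h]
      simp
  have h2 : C ≤ K * ENNReal.ofReal ε := by
    rw [← ENNReal.coe_toNNReal hC, ENNReal.ofReal, ← ENNReal.coe_mul, ENNReal.coe_le_coe, add_mul,
      div_mul_cancel₀ _ hε'.ne', one_mul]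
    exact le_add_of_nonneg_right hε'.le
  have hK : (K : ℝ≥0∞) ≠ 0 := by
    rw [Ne, ENNReal.coe_eq_zero]; exact (add_pos_of_nonneg_of_pos zero_le one_pos).ne'
  exact (ENNReal.mul_le_mul_iff_right hK ENNReal.coe_ne_top).1 (h1.trans h2)

end SelfSimilarityTest

/-! ### Transfer from the standard normal sample to the general one -/

open SelfSimilarityTest

theorem mainTheorem6
    {Ω : Type*} [MeasurableSpace Ω] (P : Measure Ω) [IsProbabilityMeasure P]
    (X : ℕ → Ω → ℝ) (μ : ℝ) (σ : ℝ≥0) (hσ : 0 < σ)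
    (hindep : iIndepFun X P) (hlaw : ∀ k, HasLaw (X k) (gaussianReal μ (σ ^ 2)) P)
    (T : ℝ) (hT : 0 < T)
    (w : ℝ → ℝ) (hw_meas : AEMeasurable w (volume.restrict (Set.Icc (-T) T)))
    (hw_nonneg : ∀ t ∈ Set.Icc (-T) T, 0 ≤ w t)
    (hw_bdd : ∃ K : ℝ, ∀ t ∈ Set.Icc (-T) T, w t ≤ K) :
    -- the functional is nonnegative and continuous for the supremum norm
    ((∀ f, 0 ≤ SelfSimilarityTest.quadFunctional T w f) ∧
      Continuous (SelfSimilarityTest.quadFunctional T w)) ∧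
    -- moments of the scaled error of the standardized empirical characteristic function
    (∀ (n : ℕ+) (t : ℝ),
      AEMeasurable (fun ω => SelfSimilarityTest.ecfError (fun k : Fin n => X k ω) t) P) ∧
    (∀ q : ℝ, 0 < q →
      ⨆ (n : ℕ+) (t ∈ Set.Icc (-T) T),
        ∫⁻ ω, ‖SelfSimilarityTest.ecfError (fun k : Fin n => X k ω) t‖ₑ ^ q ∂P < ∞) ∧
    -- moments and uniform integrability of the quadratic functional
    (∀ m : ℕ, 1 ≤ m → ∀ p : ℝ, 1 ≤ p →
      (⨆ n : ℕ+, ∫⁻ ω, ENNReal.ofReal (SelfSimilarityTest.quadFunctional T w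
          (SelfSimilarityTest.deviation T m (fun k : Fin n => X k ω)) ^ p) ∂P < ∞) ∧
      UniformIntegrable (fun (n : ℕ+) (ω : Ω) => SelfSimilarityTest.quadFunctional T w
          (SelfSimilarityTest.deviation T m (fun k : Fin n => X k ω)) ^ p) 1 P) := by
  obtain ⟨K', hK'⟩ := hw_bdd
  obtain ⟨K, hK0, hK⟩ : ∃ K : ℝ, 0 ≤ K ∧ ∀ t ∈ Set.Icc (-T) T, w t ≤ K :=
    ⟨max K' 0, le_max_right _ _, fun t ht => (hK' t ht).trans (le_max_left _ _)⟩
  have hσ' : (0 : ℝ) < σ := hσ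
  set Z : ℕ → Ω → ℝ := fun k ω => (X k ω - μ) / σ with hZ
  have hZlaw : ∀ k, HasLaw (Z k) (gaussianReal 0 1) P := fun k => by
    have h := gaussianReal_div_const (gaussianReal_sub_const (hlaw k) μ) (σ : ℝ)
    convert h using 2
    · simp
    · rw [eq_comm, div_eq_one_iff_eq]
      · ext; simp
      · exact fun h0 => hσ'.ne' (by simpa using congrArg NNReal.toReal h0)
  have hZind : iIndepFun Z P := hindep.comp (fun _ x => (x - μ) / σ) fun _ => by fun_prop
  have hsample : ∀ n : ℕ, HasLaw (fun ω (k : Fin n) => Z k ω) (stdSample n) P := fun n =>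
    iIndepFun.hasLaw_pi (fun k : Fin n => hZlaw k) (hZind.precomp Fin.val_injective)
  have hX : ∀ (n : ℕ) (ω : Ω), (fun k : Fin n => X k ω) = fun k : Fin n => σ * Z k ω + μ := by
    intro n ω
    funext k
    rw [hZ]
    field_simp
    ring
  have hU : ∀ (n : ℕ+) (ω : Ω) (t : ℝ),
      ecfError (fun k : Fin n => X k ω) t = ecfError (fun k : Fin n => Z k ω) t := fun n ω t => by
    rw [hX, ecfError_affine n.pos _ hσ']
  have hH : ∀ (n : ℕ+) (m : ℕ) (ω : Ω), deviation T m (fun k : Fin n => X k ω) =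
      deviation T m (fun k : Fin n => Z k ω) := fun n m ω => by
    rw [hX, deviation_affine T m n.pos _ hσ']
  have hUm : ∀ (n : ℕ) (t : ℝ), Measurable fun z : Fin n → ℝ => ecfError z t := fun n t =>
    measurable_ecfError measurable_id measurable_const
  refine ⟨⟨quadFunctional_nonneg hw_nonneg,
    continuous_quadFunctional hw_meas hw_nonneg hK hK0⟩, fun n t => ?_, fun q hq => ?_,
    fun m hm p hp => ?_⟩
  · simp only [hU]
    exact (hUm n t).comp_aemeasurable (hsample n).aemeasurable
  · obtain ⟨C, hC, hmom⟩ := exists_moment_ecfError_le T hq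
    refine (iSup_le fun n => iSup₂_le fun t ht => ?_).trans_lt hC.lt_top
    simp only [hU]
    exact ((hsample n).lintegral_comp (f := fun z => ‖ecfError z t‖ₑ ^ q)
      ((hUm n t).enorm.pow_const q).aemeasurable).trans_le (hmom n n.pos t (abs_le.2 ht))
  · simp only [hH]
    have hQm : ∀ n : ℕ, Measurable fun z : Fin n → ℝ => quadFunctional T w (deviation T m z) :=
      fun n => measurable_quadFunctional_deviation hw_meas m n
    have hmom : ∀ r : ℝ, 1 ≤ r → ∃ C : ℝ≥0∞, C ≠ ∞ ∧ ∀ n : ℕ+, ∫⁻ ω, ENNReal.ofReal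
        (quadFunctional T w (deviation T m (fun k : Fin n => Z k ω)) ^ r) ∂P ≤ C := fun r hr => by
      obtain ⟨C, hC, h⟩ := exists_moment_quadFunctional_le hw_nonneg hK hK0 hm hr
      exact ⟨C, hC, fun n => ((hsample n).lintegral_comp (f := fun z =>
        ENNReal.ofReal (quadFunctional T w (deviation T m z) ^ r))
        ((hQm n).pow_const r).ennreal_ofReal.aemeasurable).trans_le (h n n.pos)⟩
    refine ⟨?_, ?_⟩
    · obtain ⟨C, hC, h⟩ := hmom p hp
      exact (iSup_le h).trans_lt hC.lt_top
    -- The moment of order `2p` of the functional is the second moment of its `p`-th power.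
    · obtain ⟨C, hC, h⟩ := hmom (p * 2) (by linarith)
      refine uniformIntegrable_one_of_lintegral_sq_le (fun n => ?_) hC fun n => ?_
      · exact (((hQm n).pow_const p).comp_aemeasurable
          (hsample n).aemeasurable).aestronglyMeasurable
      · refine le_of_eq_of_le (lintegral_congr fun ω => ?_) (h n)
        have h0 := quadFunctional_nonneg hw_nonneg (deviation T m (fun k : Fin n => Z k ω))
        rw [Real.enorm_of_nonneg (by positivity), ← ENNReal.ofReal_pow (by positivity),
          Real.rpow_mul h0, Real.rpow_ofNat]
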